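/- An input-driven nondeterministic pushdown automaton with translucent letters ($\mathsf{NIDPDAwtl}$) over a finite alphabet $\Sigma$ consists of a finite state set $Q$ with initial state $q_0\in Q$, a finite set $\Gamma$ of pushdown symbols, a bottom-of-pushdown symbol $\bot\notin\Gamma$, an endmarker $\vartriangleleft\,\notin\Sigma$, a signature, i.e. a partition $\Sigma=\Sigma_D\cup\Sigma_R\cup\Sigma_N$ into disjoint (possibly empty) sets of letters that push, pop, and leave the pushdown unchanged, a translucency mapping $\tau:Q\to 2^\Sigma$, and partial transition functions $\delta_D:Q\times\Sigma_D\times(\Gamma\cup\{\bot\})\to 2^{Q\times\Gamma}\cup\{\mathtt{accept}\}$, $\delta_R:Q\times\Sigma_R\times(\Gamma\cup\{\bot\})\to 2^{Q}\cup\{\mathtt{accept}\}$, $\delta_N:Q\times(\Sigma_N\cup\{\vartriangleleft\})\times(\Gamma\cup\{\bot\})\to 2^{Q}\cup\{\mathtt{accept}\}$. It starts in $q_0$ with pushdown content $\bot$. In state $q$ with remaining input $w$ it processes the first letter of $w\!\vartriangleleft$ that is not in $\tau(q)$, according to the current top pushdown symbol, nondeterministically choosing one of the moves offered by the applicable transition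 function; a letter of $\Sigma$ that is processed is deleted, and the next step starts again at the left end of the remaining input. The symbol $\bot$ is never removed: popping when $\bot$ is on top only changes the state. A word is accepted if some computation on it reaches the value $\mathtt{accept}$. Let $\mathscr{L}(\mathsf{NIDPDAwtl})$ be the family of all languages accepted by such automata. Two languages are letter-equivalent if they have the same Parikh image. Then $\mathscr{L}(\mathsf{NIDPDAwtl})$ is neither closed under intersection nor under intersection with regular languages. More precisely, over the alphabet $\{a,b,c\}$ let $L_{a,b,c}=\{w\in\{a,b,c\}^* : |w|_a=|w|_b=|w|_c\}$ and $L_{abc}=\{a^nb^nc^n : n\ge 0\}$. Then $L_{a,b,c}$ and $a^*b^*c^*$ are accepted by $\mathsf{NIDPDAwtl}$ with identical signatures, $a^*b^*c^*$ is regular, $L_{abc}=L_{a,b,c}\cap a^*b^*c^*$, no context-free language $K\subseteq L_{abc}$ is letter-equivalent to $L_{abc}$, and $L_{abc}\notin\mathscr{L}(\mathsf{NIDPDAwtl})$. -/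

import Mathlib

open scoped Computability

/-- The action on the pushdown store that an input letter prescribes. -/
inductive StackAction where
  | push
  | pop
  | neutral

/-- A value of a transition function: either a set of possible moves, or the word `accept`. -/
inductive Outcome (X : Type) where
  | moves (S : Set X)
  | accept

/-- A (nondeterministic) input-driven pushdown automaton with translucent input letters over the
input alphabet `α`. The signature assigns to each letter its class, that is, it partitions `α` into
the letters that push, the letters that pop, and the letters that only change the state.
A pushdown symbol `z : Γ` on top is passed to the transition functions as `some z`, the
bottom-of-pushdown symbol as `none`. In `δN` the input `some a` is the letter `a`, and `none` is
the endmarker. The transition functions are partial: the value `none` means undefined. -/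
structure NIDPDAwtl (α : Type) where
  /-- internal states -/
  Q : Type
  /-- pushdown symbols, without the bottom-of-pushdown symbol -/
  Γ : Type
  finiteQ : Finite Q
  finiteΓ : Finite Γ
  /-- the partition of the input alphabet -/
  signature : α → StackAction
  /-- initial state -/
  q₀ : Q
  /-- translucency mapping -/
  τ : Q → Set α
  δD : Q → {a : α // signature a = StackAction.push} → Option Γ → Option (Outcome (Q × Γ))
  δR : Q → {a : α // signature a = StackAction.pop} → Option Γ → Option (Outcome Q)
  δN : Q → Option {a : α // signature a = StackAction.neutral} → Option Γ → Option (Outcome Q)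

namespace NIDPDAwtl

variable {α : Type} (M : NIDPDAwtl α)

/-- Configurations. In `run q w γ` the word `w` is the remaining input without the endmarker, and
`γ` is the pushdown content, top first, without the bottom-of-pushdown symbol. -/
inductive Config where
  | run (q : M.Q) (w : List α) (γ : List M.Γ)
  | accept

/-- One step in the returning mode. The first letter `a` of the remaining input that is not
translucent for the current state is processed and deleted, and the head returns to the left end;
if all remaining letters are translucent, then the endmarker is processed. The top of the pushdown
is `γ.head?`. Popping from the empty pushdown leaves it empty (`[].tail = []`). -/
inductive Step : M.Config → M.Config → Prop
  | push {q q' : M.Q} {x y : List α} {a : α} {γ : List M.Γ} {z' : M.Γ} {S : Set (M.Q × M.Γ)}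
      (h : M.signature a = StackAction.push) (hx : ∀ b ∈ x, b ∈ M.τ q) (ha : a ∉ M.τ q)
      (hδ : M.δD q ⟨a, h⟩ γ.head? = some (Outcome.moves S)) (hS : (q', z') ∈ S) :
      Step (Config.run q (x ++ a :: y) γ) (Config.run q' (x ++ y) (z' :: γ))
  | pop {q q' : M.Q} {x y : List α} {a : α} {γ : List M.Γ} {S : Set M.Q}
      (h : M.signature a = StackAction.pop) (hx : ∀ b ∈ x, b ∈ M.τ q) (ha : a ∉ M.τ q)
      (hδ : M.δR q ⟨a, h⟩ γ.head? = some (Outcome.moves S)) (hS : q' ∈ S) :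
      Step (Config.run q (x ++ a :: y) γ) (Config.run q' (x ++ y) γ.tail)
  | neutral {q q' : M.Q} {x y : List α} {a : α} {γ : List M.Γ} {S : Set M.Q}
      (h : M.signature a = StackAction.neutral) (hx : ∀ b ∈ x, b ∈ M.τ q) (ha : a ∉ M.τ q)
      (hδ : M.δN q (some ⟨a, h⟩) γ.head? = some (Outcome.moves S)) (hS : q' ∈ S) :
      Step (Config.run q (x ++ a :: y) γ) (Config.run q' (x ++ y) γ)
  | endmarker {q q' : M.Q} {x : List α} {γ : List M.Γ} {S : Set M.Q}
      (hx : ∀ b ∈ x, b ∈ M.τ q)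
      (hδ : M.δN q none γ.head? = some (Outcome.moves S)) (hS : q' ∈ S) :
      Step (Config.run q x γ) (Config.run q' x γ)
  | acceptPush {q : M.Q} {x y : List α} {a : α} {γ : List M.Γ}
      (h : M.signature a = StackAction.push) (hx : ∀ b ∈ x, b ∈ M.τ q) (ha : a ∉ M.τ q)
      (hδ : M.δD q ⟨a, h⟩ γ.head? = some Outcome.accept) :
      Step (Config.run q (x ++ a :: y) γ) Config.accept
  | acceptPop {q : M.Q} {x y : List α} {a : α} {γ : List M.Γ}
      (h : M.signature a = StackAction.pop) (hx : ∀ b ∈ x, b ∈ M.τ q) (ha : a ∉ M.τ q)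
      (hδ : M.δR q ⟨a, h⟩ γ.head? = some Outcome.accept) :
      Step (Config.run q (x ++ a :: y) γ) Config.accept
  | acceptNeutral {q : M.Q} {x y : List α} {a : α} {γ : List M.Γ}
      (h : M.signature a = StackAction.neutral) (hx : ∀ b ∈ x, b ∈ M.τ q) (ha : a ∉ M.τ q)
      (hδ : M.δN q (some ⟨a, h⟩) γ.head? = some Outcome.accept) :
      Step (Config.run q (x ++ a :: y) γ) Config.accept
  | acceptEndmarker {q : M.Q} {x : List α} {γ : List M.Γ}
      (hx : ∀ b ∈ x, b ∈ M.τ q)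
      (hδ : M.δN q none γ.head? = some Outcome.accept) :
      Step (Config.run q x γ) Config.accept

/-- The language accepted by `M`: the words with a computation that ends with `accept`. -/
def language : Language α :=
  {w | Relation.ReflTransGen M.Step (Config.run M.q₀ w []) Config.accept}

/-- The languages over the finite alphabet `α` that are accepted by some `NIDPDAwtl`. -/
def family (α : Type) [Finite α] : Set (Language α) :=
  {L | ∃ M : NIDPDAwtl α, M.language = L}

/-- The family of languages accepted by `NIDPDAwtl` is closed under intersection. -/
def ClosedUnderIntersection : Prop :=
  ∀ (α : Type) [Finite α] (L₁ L₂ : Language α),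
    L₁ ∈ family α → L₂ ∈ family α → L₁ ⊓ L₂ ∈ family α

/-- The family of languages accepted by `NIDPDAwtl` is closed under intersection with regular
languages. -/
def ClosedUnderIntersectionWithRegular : Prop :=
  ∀ (α : Type) [Finite α] (L R : Language α),
    L ∈ family α → R.IsRegular → L ⊓ R ∈ family α

end NIDPDAwtl

/-- The Parikh image of a language: the set of the vectors of letter counts of its words. -/
def parikhImage {α : Type} [DecidableEq α] (L : Language α) : Set (α → ℕ) :=
  (fun (w : List α) (a : α) => w.count a) '' L

/-- Two languages are letter-equivalent if they have the same Parikh image. -/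
def LetterEquivalent {α : Type} [DecidableEq α] (L₁ L₂ : Language α) : Prop :=
  parikhImage L₁ = parikhImage L₂

/-- The alphabet with exactly the three letters a, b, c. -/
inductive ABC where
  | a
  | b
  | c
  deriving DecidableEq

instance : Finite ABC :=
  Finite.of_injective (fun x : ABC => ((decide (x = ABC.a), decide (x = ABC.b)) : Bool × Bool))
    (by intro x y h; cases x <;> cases y <;> simp_all)

/-- The words over a, b, c with equally many occurrences of a, b and c. -/
def equalCountABC : Language ABC :=
  {w | w.count ABC.a = w.count ABC.b ∧ w.count ABC.b = w.count ABC.c}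

/-- The language a*b*c*. -/
def starABC : Language ABC :=
  ({[ABC.a]} : Language ABC)∗ * ({[ABC.b]} : Language ABC)∗ * ({[ABC.c]} : Language ABC)∗

/-- The language of the words aⁿbⁿcⁿ with n ≥ 0. -/
def powABC : Language ABC :=
  {w | ∃ n : ℕ, w = List.replicate n ABC.a ++ List.replicate n ABC.b ++ List.replicate n ABC.c}

/-! Both failures of closure come from `powABC ∉ family ABC`. An automaton deleting `a`, `b`, `c` in
cyclic order accepts `equalCountABC`, a DFA accepts `starABC`, and neither uses its pushdown, so all
letters are neutral in both.

For the non-membership, a letter that is processed is not translucent, so it may be moved to the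
front of the remaining input. Hence every accepted word has a permutation that is read from left to
right, unless acceptance comes early; in that case one more copy of a letter still present is
harmless (`exists_perm_full`). Inside `powABC` a permutation is the word itself and lengths are
divisible by 3, so each `aⁿbⁿcⁿ` is read completely from left to right. For `n` the number of pairs
of a state and a top symbol, two moments within a block of `n` equal letters show the same pair. The
signature fixes all pushdown heights, so some block can be cut between two such moments
(`Full.shorten`): one during which the pushdown does not change, or one after whose start the
symbols present are never popped.

Non-context-freeness is shown without pumping. A factor of `aⁿbⁿcⁿ` shorter than `n` is determined
by its context. Going up a parse tree, every subtree therefore has a nonterminal yielding a single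
word, of length bounded by the right-hand sides of the rules, and this reaches the root. So the
initial symbol would have minimal length `3n` for all large `n` at once. -/

/-! ### The words `aⁿbⁿcⁿ` -/

/-- The word `aⁿbⁿcⁿ`. -/
def powWord (n : ℕ) : List ABC :=
  List.replicate n ABC.a ++ List.replicate n ABC.b ++ List.replicate n ABC.c

theorem mem_powABC {w : List ABC} : w ∈ powABC ↔ ∃ n, w = powWord n := Iff.rfl

theorem powWord_mem (n : ℕ) : powWord n ∈ powABC := ⟨n, rfl⟩

@[simp] theorem length_powWord (n : ℕ) : (powWord n).length = 3 * n := by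
  simp [powWord]; ring

theorem getElem?_powWord (n i : ℕ) :
    (powWord n)[i]? = if i < n then some ABC.a else if i < 2 * n then some ABC.b
      else if i < 3 * n then some ABC.c else none := by
  simp only [powWord, List.getElem?_append, List.getElem?_replicate, List.length_append,
    List.length_replicate]
  split_ifs <;> first | rfl | omega

theorem getElem?_powWord_eq_a {n i : ℕ} : (powWord n)[i]? = some ABC.a ↔ i < n := by
  rw [getElem?_powWord]
  split_ifs <;> simp <;> omega

theorem getElem?_powWord_eq_b {n i : ℕ} :
    (powWord n)[i]? = some ABC.b ↔ n ≤ i ∧ i < 2 * n := by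
  rw [getElem?_powWord]
  split_ifs <;> simp <;> omega

theorem getElem?_powWord_eq_c {n i : ℕ} :
    (powWord n)[i]? = some ABC.c ↔ 2 * n ≤ i ∧ i < 3 * n := by
  rw [getElem?_powWord]
  split_ifs <;> simp <;> omega

/-- A factor of `aⁿbⁿcⁿ` of length less than `n` cannot be exchanged within `powABC`. -/
theorem eq_of_powWord_context {n : ℕ} {u v w w' : List ABC} (h : u ++ w ++ v = powWord n)
    (hw : w.length < n) (h' : u ++ w' ++ v ∈ powABC) : w' = w := by
  obtain ⟨m, hm⟩ := h'
  change _ = powWord m at hm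
  suffices hmn : m = n by
    subst hmn
    simpa using hm.trans h.symm
  have hl := congrArg List.length h
  have hl' := congrArg List.length hm
  simp only [List.length_append, length_powWord] at hl hl'
  -- Either `u` contains the border between the blocks of `a` and `b`, whose distance from the left
  -- end gives `m = n`, or `v` contains the border between `b` and `c`, whose distance from the
  -- right end does.
  by_cases hu : n < u.length
  · have key : ∀ i < u.length, (powWord n)[i]? = (powWord m)[i]? := fun i hi => by
      rw [← h, ← hm, List.append_assoc, List.append_assoc, List.getElem?_append_left hi,
        List.getElem?_append_left hi]
    have h1 := key n hu
    have h2 := key (n - 1) (by omega)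
    rw [getElem?_powWord_eq_b.2 (by omega), eq_comm, getElem?_powWord_eq_b] at h1
    rw [getElem?_powWord_eq_a.2 (by omega), eq_comm, getElem?_powWord_eq_a] at h2
    omega
  · have hv : n < v.length := by omega
    have key : ∀ i < v.length, (powWord n)[3 * n - v.length + i]? =
        (powWord m)[3 * m - v.length + i]? := fun i hi => by
      rw [← h, ← hm, List.getElem?_append_right (by simp; omega),
        List.getElem?_append_right (by simp; omega)]
      congr 1
      simp only [List.length_append]
      omega
    have h1 := key (v.length - n - 1) (by omega)
    have h2 := key (v.length - n) (by omega)
    rw [getElem?_powWord_eq_b.2 (by omega), eq_comm, getElem?_powWord_eq_b] at h1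
    rw [getElem?_powWord_eq_c.2 (by omega), eq_comm, getElem?_powWord_eq_c] at h2
    omega

/-! ### Yields of sentential forms -/

namespace ContextFreeGrammar

variable {T : Type} (g : ContextFreeGrammar T)

/-- `g.Yields s w`: the sentential form `s` has a parse forest with frontier `w`. -/
inductive Yields : List (Symbol T g.NT) → List T → Prop
  | nil : Yields [] []
  | terminal {s : List (Symbol T g.NT)} {w : List T} (t : T) (h : Yields s w) :
      Yields (Symbol.terminal t :: s) (t :: w)
  | nonterminal {r : ContextFreeRule T g.NT} {s : List (Symbol T g.NT)} {w₁ w₂ : List T}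
      (hr : r ∈ g.rules) (h₁ : Yields r.output w₁) (h₂ : Yields s w₂) :
      Yields (Symbol.nonterminal r.input :: s) (w₁ ++ w₂)

variable {g}

theorem Yields.append {s₁ s₂ : List (Symbol T g.NT)} {w₁ w₂ : List T} (h₁ : g.Yields s₁ w₁)
    (h₂ : g.Yields s₂ w₂) : g.Yields (s₁ ++ s₂) (w₁ ++ w₂) := by
  induction h₁ with
  | nil => exact h₂
  | terminal t _ ih => exact ih.terminal t
  | nonterminal hr h _ _ ih =>
    rw [List.append_assoc]
    exact .nonterminal hr h ih

theorem Yields.exists_append {s₁ s₂ : List (Symbol T g.NT)} {w : List T}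
    (h : g.Yields (s₁ ++ s₂) w) :
    ∃ w₁ w₂, w = w₁ ++ w₂ ∧ g.Yields s₁ w₁ ∧ g.Yields s₂ w₂ := by
  induction s₁ generalizing w with
  | nil => exact ⟨[], w, rfl, .nil, h⟩
  | cons x s ih =>
    cases h with
    | terminal t h =>
      obtain ⟨w₁, w₂, rfl, h₁, h₂⟩ := ih h
      exact ⟨t :: w₁, w₂, rfl, h₁.terminal t, h₂⟩
    | @nonterminal r _ w₀ _ hr h₀ h =>
      obtain ⟨w₁, w₂, rfl, h₁, h₂⟩ := ih h
      exact ⟨w₀ ++ w₁, w₂, (List.append_assoc _ _ _).symm, .nonterminal hr h₀ h₁, h₂⟩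

theorem yields_map_terminal (w : List T) : g.Yields (w.map Symbol.terminal) w := by
  induction w with
  | nil => exact .nil
  | cons t w ih => exact ih.terminal t

theorem Yields.of_derives {s : List (Symbol T g.NT)} {w : List T}
    (h : g.Derives s (w.map Symbol.terminal)) : g.Yields s w := by
  induction h using Relation.ReflTransGen.head_induction_on with
  | refl => exact yields_map_terminal w
  | head hp _ ih =>
    obtain ⟨r, hr, hrw⟩ := hp
    obtain ⟨p, q, rfl, rfl⟩ := hrw.exists_parts
    obtain ⟨w₁, w₂, rfl, h₁, h₂⟩ := ih.exists_append
    obtain ⟨w₃, w₄, rfl, h₃, h₄⟩ := h₁.exists_append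
    have := Yields.nonterminal hr h₄ .nil
    rw [List.append_nil] at this
    exact (h₃.append this).append h₂

theorem Yields.derives {s : List (Symbol T g.NT)} {w : List T} (h : g.Yields s w) :
    g.Derives s (w.map Symbol.terminal) := by
  induction h with
  | nil => exact Relation.ReflTransGen.refl
  | terminal t _ ih => exact ih.append_left [Symbol.terminal t]
  | @nonterminal r s w₁ w₂ hr _ _ ih₁ ih₂ =>
    rw [List.map_append]
    have h₀ : g.Produces [Symbol.nonterminal r.input] r.output := ⟨r, hr, .input_output⟩
    exact ((h₀.trans_derives ih₁).append_right s).trans (ih₂.append_left _)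

/-- Replaces derivation sequences by parse forests, which allow structural induction. -/
theorem mem_language_iff_yields {w : List T} :
    w ∈ g.language ↔ g.Yields [Symbol.nonterminal g.initial] w :=
  ⟨Yields.of_derives, Yields.derives⟩

variable (g)

/-- The least length of a word derived from a symbol. -/
noncomputable def minLength (x : Symbol T g.NT) : ℕ :=
  sInf {l | ∃ w, g.Yields [x] w ∧ w.length = l}

variable {g}

/-- The only way in which `minLength` is evaluated: for symbols with exactly one yield. The value
`sInf ∅ = 0` at symbols without a yield does no harm. -/
theorem minLength_eq {x : Symbol T g.NT} {w : List T} (h : g.Yields [x] w)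
    (hu : ∀ w', g.Yields [x] w' → w' = w) : g.minLength x = w.length := by
  have : {l | ∃ w, g.Yields [x] w ∧ w.length = l} = {w.length} := by
    ext l
    constructor
    · rintro ⟨w', h', rfl⟩
      rw [hu w' h']
      rfl
    · rintro rfl
      exact ⟨w, h, rfl⟩
  rw [minLength, this, csInf_singleton]

theorem minLength_terminal (t : T) : g.minLength (Symbol.terminal t) = 1 := by
  refine minLength_eq (w := [t]) (Yields.nil.terminal t) fun w' h => ?_
  cases h with
  | terminal _ h => cases h; rfl

end ContextFreeGrammar

/-! ### Rigid parse trees and non-context-freeness -/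

open ContextFreeGrammar in
/-- If the right-hand sides of all rules have total minimal length less than `n`, then all
sentential forms inside a parse tree of `aⁿbⁿcⁿ` yield only words of minimal length. -/
theorem ContextFreeGrammar.Yields.length_eq_of_context {g : ContextFreeGrammar ABC} {n : ℕ}
    (hn : ∀ r ∈ g.rules, (r.output.map g.minLength).sum < n) {s : List (Symbol ABC g.NT)}
    {w : List ABC} (h : g.Yields s w) {u v : List ABC} (huv : u ++ w ++ v = powWord n)
    (hs : ∀ w', g.Yields s w' → u ++ w' ++ v ∈ powABC) :
    w.length = (s.map g.minLength).sum := by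
  induction h generalizing u v with
  | nil => rfl
  | terminal t _ ih =>
    have := ih (u := u ++ [t]) (v := v) (by simpa using huv)
      fun w' h' => by simpa using hs _ (h'.terminal t)
    simp only [List.length_cons, this, List.map_cons, List.sum_cons, minLength_terminal]
    ring
  | @nonterminal r s w₁ w₂ hr h₁ h₂ ih₁ ih₂ =>
    have e₁ := ih₁ (u := u) (v := w₂ ++ v) (by simpa using huv)
      fun w' h' => by simpa using hs _ (.nonterminal hr h' h₂)
    have e₂ := ih₂ (u := u ++ w₁) (v := v) (by simpa using huv)
      fun w' h' => by simpa using hs _ (.nonterminal hr h₁ h')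
    have h₀ : g.Yields [Symbol.nonterminal r.input] w₁ := by
      simpa using Yields.nonterminal hr h₁ .nil
    -- By `e₁` and the bound for `r`, `w₁` is shorter than `n`, so no other word fits into its
    -- context: it is the only yield of the nonterminal.
    have e₃ : g.minLength (Symbol.nonterminal r.input) = w₁.length := by
      refine minLength_eq h₀ fun w' h' => ?_
      refine eq_of_powWord_context (n := n) (u := u) (v := w₂ ++ v) (by simpa using huv)
        (e₁ ▸ hn r hr) ?_
      simpa using hs _ (h'.append h₂)
    simp [e₂, e₃]

open ContextFreeGrammar in
theorem not_isContextFree_powABC : ¬ powABC.IsContextFree := by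
  rintro ⟨g, hg⟩
  have hbound : ∃ N, ∀ r ∈ g.rules, (r.output.map g.minLength).sum < N :=
    ⟨g.rules.sup (fun r => (r.output.map g.minLength).sum) + 1, fun r hr =>
      Nat.lt_succ_of_le (Finset.le_sup (f := fun r => (r.output.map g.minLength).sum) hr)⟩
  obtain ⟨N, hN⟩ := hbound
  -- The whole word is its own factor with empty context; the right side does not depend on `n`.
  have key : ∀ n, N ≤ n → 3 * n = g.minLength (Symbol.nonterminal g.initial) := fun n hn => by
    have h : g.Yields [Symbol.nonterminal g.initial] (powWord n) :=
      mem_language_iff_yields.1 (hg ▸ powWord_mem n)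
    have := h.length_eq_of_context (n := n) (fun r hr => (hN r hr).trans_le hn) (u := [])
      (v := []) (by simp) fun w' h' => by simpa [← hg] using mem_language_iff_yields.2 h'
    simpa using this
  have h₁ := key N le_rfl
  have h₂ := key (N + 1) (Nat.le_succ N)
  omega

/-- A word of `powABC` is determined by its length, hence by its Parikh vector, so no proper
sublanguage has the same Parikh image. -/
theorem LetterEquivalent.eq_powABC {K : Language ABC} (hK : K ≤ powABC)
    (h : LetterEquivalent K powABC) : K = powABC := by
  refine le_antisymm hK fun w hw => ?_
  obtain ⟨w', hw', e⟩ : (fun x => w.count x) ∈ parikhImage K := h ▸ ⟨w, hw, rfl⟩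
  have hp : w'.Perm w := List.perm_iff_count.2 (congrFun e)
  obtain ⟨m, rfl⟩ := mem_powABC.1 hw
  obtain ⟨n, rfl⟩ := mem_powABC.1 (hK hw')
  have := hp.length_eq
  simp only [length_powWord] at this
  obtain rfl : n = m := by omega
  exact hw'

/-! ### Computations that read the input from left to right -/

namespace NIDPDAwtl

variable {α : Type} (M : NIDPDAwtl α)

/-- `M.Move q a γ q' γ'`: in state `q` with pushdown content `γ`, processing the letter `a` may
lead to state `q'` with pushdown content `γ'`. -/
inductive Move : M.Q → α → List M.Γ → M.Q → List M.Γ → Prop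
  | push {q q' : M.Q} {a : α} {γ : List M.Γ} {z : M.Γ} {S : Set (M.Q × M.Γ)}
      (h : M.signature a = StackAction.push) (ha : a ∉ M.τ q)
      (hδ : M.δD q ⟨a, h⟩ γ.head? = some (Outcome.moves S)) (hS : (q', z) ∈ S) :
      Move q a γ q' (z :: γ)
  | pop {q q' : M.Q} {a : α} {γ : List M.Γ} {S : Set M.Q}
      (h : M.signature a = StackAction.pop) (ha : a ∉ M.τ q)
      (hδ : M.δR q ⟨a, h⟩ γ.head? = some (Outcome.moves S)) (hS : q' ∈ S) :
      Move q a γ q' γ.tail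
  | neutral {q q' : M.Q} {a : α} {γ : List M.Γ} {S : Set M.Q}
      (h : M.signature a = StackAction.neutral) (ha : a ∉ M.τ q)
      (hδ : M.δN q (some ⟨a, h⟩) γ.head? = some (Outcome.moves S)) (hS : q' ∈ S) :
      Move q a γ q' γ

/-- `M.Full q γ u`: from state `q` and pushdown content `γ` the word `u` can be processed
completely from left to right, with acceptance on the endmarker when nothing is left. -/
inductive Full : M.Q → List M.Γ → List α → Prop
  | letter {q q' : M.Q} {γ γ' : List M.Γ} {a : α} {u : List α}
      (hm : M.Move q a γ q' γ') (h : Full q' γ' u) : Full q γ (a :: u)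
  | endmarker {q q' : M.Q} {γ : List M.Γ} {u : List α} {S : Set M.Q}
      (hu : ∀ b ∈ u, b ∈ M.τ q) (hδ : M.δN q none γ.head? = some (Outcome.moves S))
      (hS : q' ∈ S) (h : Full q' γ u) : Full q γ u
  | accept {q : M.Q} {γ : List M.Γ} (hδ : M.δN q none γ.head? = some Outcome.accept) :
      Full q γ []

/-- `M.Run q γ p s q' γ'`: from state `q` and pushdown content `γ`, on input `p ++ s`, the prefix
`p` can be processed from left to right, with state `q'` and pushdown content `γ'` reached. -/
inductive Run : M.Q → List M.Γ → List α → List α → M.Q → List M.Γ → Prop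
  | nil (q : M.Q) (γ : List M.Γ) (s : List α) : Run q γ [] s q γ
  | letter {q q₁ q' : M.Q} {γ γ₁ γ' : List M.Γ} {a : α} {p s : List α}
      (hm : M.Move q a γ q₁ γ₁) (h : Run q₁ γ₁ p s q' γ') : Run q γ (a :: p) s q' γ'
  | endmarker {q q₁ q' : M.Q} {γ γ' : List M.Γ} {p s : List α} {S : Set M.Q}
      (hu : ∀ b ∈ p ++ s, b ∈ M.τ q) (hδ : M.δN q none γ.head? = some (Outcome.moves S))
      (hS : q₁ ∈ S) (h : Run q₁ γ p s q' γ') : Run q γ p s q' γ'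

variable {M}

theorem Move.step {q q' : M.Q} {γ γ' : List M.Γ} {a : α} (h : M.Move q a γ q' γ')
    (u : List α) : M.Step (.run q (a :: u) γ) (.run q' u γ') := by
  cases h with
  | push h ha hδ hS => exact Step.push (x := []) h (by simp) ha hδ hS
  | pop h ha hδ hS => exact Step.pop (x := []) h (by simp) ha hδ hS
  | neutral h ha hδ hS => exact Step.neutral (x := []) h (by simp) ha hδ hS

theorem Full.accepts {q : M.Q} {γ : List M.Γ} {u : List α} (h : M.Full q γ u) :
    Relation.ReflTransGen M.Step (.run q u γ) .accept := by
  induction h with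
  | letter hm _ ih => exact .head (hm.step _) ih
  | endmarker hu hδ hS _ ih => exact .head (.endmarker hu hδ hS) ih
  | accept hδ => exact .single (.acceptEndmarker (by simp) hδ)

/-- The letters of an accepted word can be permuted such that the new word is processed from left
to right, or is accepted before it is processed completely. -/
theorem exists_perm_full {q : M.Q} {γ : List M.Γ} {w : List α}
    (h : Relation.ReflTransGen M.Step (.run q w γ) .accept) :
    ∃ u, u.Perm w ∧ (M.Full q γ u ∨ ∃ a ∈ u,
      Relation.ReflTransGen M.Step (.run q (u ++ [a]) γ) .accept) := by
  generalize hc : Config.run q w γ = c at h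
  induction h using Relation.ReflTransGen.head_induction_on generalizing q γ w with
  | refl => cases hc
  | head hs _ ih =>
    subst hc
    have letter : ∀ {q' : M.Q} {γ' : List M.Γ} {a : α} {x y : List α}, M.Move q a γ q' γ' →
        (∃ u, u.Perm (x ++ y) ∧ (M.Full q' γ' u ∨ ∃ a ∈ u,
          Relation.ReflTransGen M.Step (.run q' (u ++ [a]) γ') .accept)) →
        ∃ u, u.Perm (x ++ a :: y) ∧ (M.Full q γ u ∨ ∃ a ∈ u,
          Relation.ReflTransGen M.Step (.run q (u ++ [a]) γ) .accept) := by
      rintro q' γ' a x y hm ⟨u, hu, h⟩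
      refine ⟨a :: u, (hu.cons a).trans List.perm_middle.symm, h.imp (.letter hm) ?_⟩
      rintro ⟨b, hb, h⟩
      exact ⟨b, List.mem_cons_of_mem _ hb, .head (hm.step _) h⟩
    have early : ∀ {a : α} {x y : List α},
        (∀ v, M.Step (.run q (a :: v) γ) .accept) →
        ∃ u, u.Perm (x ++ a :: y) ∧ (M.Full q γ u ∨ ∃ a ∈ u,
          Relation.ReflTransGen M.Step (.run q (u ++ [a]) γ) .accept) := fun {a x y} hacc =>
      ⟨a :: (x ++ y), List.perm_middle.symm, .inr ⟨a, by simp, .single (hacc _)⟩⟩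
    cases hs with
    | push h hx ha hδ hS => exact letter (.push h ha hδ hS) (ih rfl)
    | pop h hx ha hδ hS => exact letter (.pop h ha hδ hS) (ih rfl)
    | neutral h hx ha hδ hS => exact letter (.neutral h ha hδ hS) (ih rfl)
    | endmarker hx hδ hS =>
      obtain ⟨u, hu, h⟩ := ih rfl
      refine ⟨u, hu, h.imp (.endmarker (fun b hb => hx b (hu.subset hb)) hδ hS) ?_⟩
      -- The extra letter already occurs in `u`, so it is translucent along with the others.
      rintro ⟨a, ha, h⟩
      refine ⟨a, ha, .head (.endmarker (fun b hb => hx b (hu.subset ?_)) hδ hS) h⟩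
      rcases List.mem_append.1 hb with hb | hb
      · exact hb
      · rwa [List.mem_singleton.1 hb]
    | acceptPush h hx ha hδ =>
      exact early fun v => .acceptPush (x := []) h (by simp) ha hδ
    | acceptPop h hx ha hδ =>
      exact early fun v => .acceptPop (x := []) h (by simp) ha hδ
    | acceptNeutral h hx ha hδ =>
      exact early fun v => .acceptNeutral (x := []) h (by simp) ha hδ
    | acceptEndmarker hx hδ =>
      refine ⟨w, .refl _, ?_⟩
      cases w with
      | nil => exact .inl (.accept hδ)
      | cons a w =>
        refine .inr ⟨a, by simp, .single (.acceptEndmarker (fun b hb => hx b ?_) hδ)⟩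
        simp only [List.mem_append, List.mem_singleton] at hb
        rcases hb with hb | rfl
        · exact hb
        · simp

theorem Full.split {q : M.Q} {γ : List M.Γ} {p s : List α} (h : M.Full q γ (p ++ s)) :
    ∃ q' γ', M.Run q γ p s q' γ' ∧ M.Full q' γ' s := by
  generalize hu : p ++ s = u at h
  induction h generalizing p with
  | @letter q q₁ γ γ₁ a u hm h ih =>
    cases p with
    | nil =>
      subst hu
      exact ⟨_, _, .nil _ _ _, .letter hm h⟩
    | cons b p =>
      simp only [List.cons_append, List.cons.injEq] at hu
      obtain ⟨rfl, hu⟩ := hu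
      obtain ⟨q', γ', h₁, h₂⟩ := ih hu
      exact ⟨q', γ', .letter hm h₁, h₂⟩
  | endmarker hx hδ hS _ ih =>
    obtain ⟨q', γ', h₁, h₂⟩ := ih hu
    exact ⟨q', γ', .endmarker (hu ▸ hx) hδ hS h₁, h₂⟩
  | accept hδ =>
    obtain ⟨rfl, rfl⟩ := List.append_eq_nil_iff.1 hu
    exact ⟨_, _, .nil _ _ _, .accept hδ⟩

/-- The unread suffix influences the run only through the translucency test of endmarker steps,
which depends on its set of letters alone. -/
theorem Run.full {q q' : M.Q} {γ γ' : List M.Γ} {p s s' : List α} (h : M.Run q γ p s q' γ')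
    (hs : s' ⊆ s) (h' : M.Full q' γ' s') : M.Full q γ (p ++ s') := by
  induction h with
  | nil => exact h'
  | letter hm _ ih => exact .letter hm (ih hs h')
  | endmarker hu hδ hS _ ih =>
    refine .endmarker (fun b hb => hu b ?_) hδ hS (ih hs h')
    rw [List.mem_append] at hb ⊢
    exact hb.imp_right fun hb => hs hb

/-! ### Pushdown contents after blocks of equal letters -/

/-- Input-drivenness: endmarker steps leave the pushdown alone, so the height depends only on the
letters read. -/
theorem Run.stack_push {q q' : M.Q} {γ γ' : List M.Γ} {a : α} {k : ℕ} {s : List α}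
    (ha : M.signature a = .push) (h : M.Run q γ (List.replicate k a) s q' γ') :
    γ'.length = k + γ.length := by
  generalize hp : List.replicate k a = p at h
  induction h generalizing k with
  | nil => simp_all
  | letter hm _ ih =>
    cases k with
    | zero => simp at hp
    | succ k =>
      simp only [List.replicate_succ, List.cons.injEq] at hp
      obtain ⟨rfl, hp⟩ := hp
      rw [ih hp]
      cases hm <;> simp_all
      omega
  | endmarker _ _ _ _ ih => exact ih hp

theorem Run.stack_pop {q q' : M.Q} {γ γ' : List M.Γ} {a : α} {k : ℕ} {s : List α}
    (ha : M.signature a = .pop) (h : M.Run q γ (List.replicate k a) s q' γ') :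
    γ' = γ.drop k := by
  generalize hp : List.replicate k a = p at h
  induction h generalizing k with
  | nil => simp_all
  | letter hm _ ih =>
    cases k with
    | zero => simp at hp
    | succ k =>
      simp only [List.replicate_succ, List.cons.injEq] at hp
      obtain ⟨rfl, hp⟩ := hp
      rw [ih hp]
      cases hm <;> simp_all
  | endmarker _ _ _ _ ih => exact ih hp

theorem Run.stack_neutral {q q' : M.Q} {γ γ' : List M.Γ} {a : α} {k : ℕ} {s : List α}
    (ha : M.signature a = .neutral) (h : M.Run q γ (List.replicate k a) s q' γ') : γ' = γ := by
  generalize hp : List.replicate k a = p at h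
  induction h generalizing k with
  | nil => rfl
  | letter hm _ ih =>
    cases k with
    | zero => simp at hp
    | succ k =>
      simp only [List.replicate_succ, List.cons.injEq] at hp
      obtain ⟨rfl, hp⟩ := hp
      rw [ih hp]
      cases hm <;> simp_all
  | endmarker _ _ _ _ ih => exact ih hp

theorem Run.stack_nil {q q' : M.Q} {γ' : List M.Γ} {a : α} {k : ℕ} {s : List α}
    (ha : M.signature a ≠ .push) (h : M.Run q [] (List.replicate k a) s q' γ') : γ' = [] := by
  cases e : M.signature a with
  | push => exact absurd e ha
  | pop => simpa using h.stack_pop e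
  | neutral => exact h.stack_neutral e

/-! ### Words that do not reach below a given level of the pushdown -/

/-- `Safe f k u`: with signature `f` and `k` symbols on top of some pushdown content, the word `u`
never pops a symbol of that content. -/
def Safe (f : α → StackAction) : ℕ → List α → Prop
  | _, [] => True
  | k, a :: u =>
    match f a with
    | .push => Safe f (k + 1) u
    | .neutral => Safe f k u
    | .pop => 0 < k ∧ Safe f (k - 1) u

theorem safe_replicate_push {f : α → StackAction} {a : α} (ha : f a = .push) {k m : ℕ}
    {s : List α} (h : Safe f (k + m) s) : Safe f k (List.replicate m a ++ s) := by
  induction m generalizing k with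
  | zero => exact h
  | succ m ih =>
    rw [List.replicate_succ, List.cons_append, Safe, ha]
    exact ih (by rwa [Nat.add_right_comm])

theorem safe_replicate (f : α → StackAction) (a : α) {k m : ℕ} (h : m ≤ k) :
    Safe f k (List.replicate m a) := by
  induction m generalizing k with
  | zero => exact trivial
  | succ m ih =>
    rw [List.replicate_succ, Safe]
    cases f a
    · exact ih (by omega)
    · exact ⟨by omega, ih (by omega)⟩
    · exact ih (by omega)

/-- Only the topmost symbol of the part of the pushdown that is not popped is relevant. -/
theorem Full.congr_stack {q : M.Q} {σ γ γ' : List M.Γ} {u : List α} (h : M.Full q (σ ++ γ) u)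
    (hu : Safe M.signature σ.length u) (hγ : γ.head? = γ'.head?) : M.Full q (σ ++ γ') u := by
  have head (σ : List M.Γ) : (σ ++ γ).head? = (σ ++ γ').head? := by
    cases σ <;> simp [hγ]
  generalize hδ : σ ++ γ = δ at h
  induction h generalizing σ with
  | letter hm _ ih =>
    subst hδ
    cases hm with
    | push e ha hδ hS =>
      rw [Safe, e] at hu
      exact .letter (.push e ha (head σ ▸ hδ) hS) (ih (σ := _ :: σ) hu rfl)
    | pop e ha hδ hS =>
      rw [Safe, e] at hu
      cases σ with
      | nil => exact absurd hu.1 (lt_irrefl 0)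
      | cons z σ =>
        exact .letter (.pop e ha (head _ ▸ hδ) hS) (ih (σ := σ) hu.2 rfl)
    | neutral e ha hδ hS =>
      rw [Safe, e] at hu
      exact .letter (.neutral e ha (head σ ▸ hδ) hS) (ih (σ := σ) hu rfl)
  | endmarker hx hδ' hS _ ih =>
    subst hδ
    exact .endmarker hx (head σ ▸ hδ') hS (ih hu rfl)
  | accept hδ' =>
    subst hδ
    exact .accept (head σ ▸ hδ')

/-- A long block of equal letters can be shortened if either the pushdown does not change while it
is read, or the part of the pushdown below it is not reached any more. -/
theorem Full.shorten {q : M.Q} {γ : List M.Γ} {a : α} {n : ℕ} {s : List α}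
    (h : M.Full q γ (List.replicate n a ++ s)) (hn : Nat.card (M.Q × Option M.Γ) ≤ n)
    (hγ : (∀ k s q' γ', M.Run q γ (List.replicate k a) s q' γ' → γ' = γ) ∨
      ∀ m, Safe M.signature 0 (List.replicate m a ++ s)) :
    ∃ k < n, M.Full q γ (List.replicate k a ++ s) := by
  -- Snapshots of one computation after each of the prefixes `aⁱ`, `0 ≤ i ≤ n`: one more than there
  -- are pairs of a state and a top symbol.
  have hex : ∀ i : Fin (n + 1), ∃ c : M.Q × List M.Γ,
      M.Run q γ (List.replicate i a) (List.replicate (n - i) a ++ s) c.1 c.2 ∧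
        M.Full c.1 c.2 (List.replicate (n - i) a ++ s) := fun i => by
    have hi : n = i + (n - i) := by omega
    rw [hi, List.replicate_add, List.append_assoc] at h
    obtain ⟨q', γ', h'⟩ := h.split
    exact ⟨(q', γ'), h'⟩
  choose c hc using hex
  have := M.finiteQ
  have := M.finiteΓ
  obtain ⟨i, j, hij, e⟩ : ∃ i j, i < j ∧ ((c i).1, (c i).2.head?) = ((c j).1, (c j).2.head?) := by
    have := Fintype.ofFinite (M.Q × Option M.Γ)
    obtain ⟨i, j, hij, e⟩ := Fintype.exists_ne_map_eq_of_card_lt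
      (fun i => ((c i).1, (c i).2.head?)) (by
        rw [← Nat.card_eq_fintype_card, Fintype.card_fin]; omega)
    rcases lt_or_gt_of_ne hij with h | h
    · exact ⟨i, j, h, e⟩
    · exact ⟨j, i, h, e.symm⟩
  simp only [Prod.mk.injEq] at e
  -- The configuration after `aⁱ` can take over the rest of the computation that follows `aʲ`, which
  -- removes `j - i` letters.
  have hF : M.Full (c i).1 (c i).2 (List.replicate (n - j) a ++ s) := by
    rw [e.1]
    rcases hγ with hγ | hγ
    · rw [hγ _ _ _ _ (hc i).1, ← hγ _ _ _ _ (hc j).1]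
      exact (hc j).2
    · exact Full.congr_stack (σ := []) (hc j).2 (hγ _) e.2.symm
  have hlt : (i : ℕ) < j := hij
  refine ⟨i + (n - j), by omega, ?_⟩
  rw [List.replicate_add, List.append_assoc]
  refine (hc i).1.full ?_ hF
  intro b hb
  simp only [List.mem_append, List.mem_replicate] at hb ⊢
  refine hb.imp_left fun hb => ⟨?_, hb.2⟩
  omega

end NIDPDAwtl

/-! ### No automaton accepts `powABC` -/

open NIDPDAwtl in
theorem powABC_notMem_family : powABC ∉ NIDPDAwtl.family ABC := by
  rintro ⟨M, hM⟩
  have full : ∀ n, M.Full M.q₀ [] (powWord n) := fun n => by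
    have hn : powWord n ∈ M.language := hM ▸ powWord_mem n
    obtain ⟨u, hu, h | ⟨x, _, h⟩⟩ := exists_perm_full hn
    · obtain ⟨m, rfl⟩ : u ∈ powABC := hM ▸ h.accepts
      have := hu.length_eq
      change (powWord m).length = _ at this
      simp only [length_powWord] at this
      obtain rfl : m = n := by omega
      exact h
    -- Early acceptance would put a word of length `3 * n + 1` into `powABC`.
    · obtain ⟨m, hm⟩ : u ++ [x] ∈ powABC := hM ▸ h
      have := congrArg List.length (show _ = powWord m from hm)
      simp only [List.length_append, hu.length_eq, length_powWord, List.length_singleton] at this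
      omega
  have mem : ∀ {i j k}, M.Full M.q₀ [] (List.replicate i ABC.a ++ (List.replicate j ABC.b ++
      List.replicate k ABC.c)) → i = j ∧ j = k := fun {i j k} h => by
    have hL : _ ∈ M.language := h.accepts
    rw [hM] at hL
    obtain ⟨m, hm⟩ := hL
    have ha := congrArg (List.count ABC.a) hm
    have hb := congrArg (List.count ABC.b) hm
    have hc := congrArg (List.count ABC.c) hm
    simp [List.count_replicate] at ha hb hc
    omega
  obtain ⟨n, hn⟩ : ∃ n, Nat.card (M.Q × Option M.Γ) = n := ⟨_, rfl⟩
  have h := full n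
  rw [powWord, List.append_assoc] at h
  by_cases ha : M.signature ABC.a = .push
  swap
  -- Without pushes the initially empty pushdown stays empty during the block of `a`.
  · obtain ⟨k, hk, h'⟩ := h.shorten hn.le (.inl fun _ _ _ _ hr => hr.stack_nil ha)
    have := mem h'
    omega
  obtain ⟨q₁, γ₁, r₁, h₁⟩ := h.split
  cases hb : M.signature ABC.b with
  | push =>
    -- The `n` symbols pushed by the `b`s suffice for the at most `n` pops by the `c`s, so nothing
    -- from the block of `a` is needed.
    obtain ⟨k, hk, h'⟩ := h.shorten hn.le (.inr fun m => safe_replicate_push ha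
      (safe_replicate_push hb (safe_replicate _ _ (by omega))))
    have := mem h'
    omega
  | neutral =>
    obtain ⟨k, hk, h'⟩ := h₁.shorten hn.le (.inl fun _ _ _ _ hr => hr.stack_neutral hb)
    have := mem (r₁.full (fun x hx => by
      simp only [List.mem_append, List.mem_replicate] at hx ⊢
      exact hx.imp_left fun hx => ⟨by omega, hx.2⟩) h')
    omega
  | pop =>
    obtain ⟨q₂, γ₂, r₂, h₂⟩ := h₁.split
    -- The `b`s pop all `n` symbols pushed by the `a`s, so the block of `c` starts on an empty
    -- pushdown: it either only pushes or leaves it empty.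
    have hγ₂ : γ₂ = [] := by
      rw [r₂.stack_pop hb]
      have := r₁.stack_push ha
      exact List.drop_eq_nil_of_le (by simp [this])
    subst hγ₂
    rw [← List.append_nil (List.replicate n ABC.c)] at h₂
    obtain ⟨k, hk, h'⟩ := h₂.shorten hn.le (by
      by_cases hc : M.signature ABC.c = .push
      · exact .inr fun m => safe_replicate_push hc trivial
      · exact .inl fun _ _ _ _ hr => hr.stack_nil hc)
    rw [List.append_nil] at h'
    have hsub : List.replicate k ABC.c ⊆ List.replicate n ABC.c := fun x hx => by
      simp only [List.mem_replicate] at hx ⊢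
      exact ⟨by omega, hx.2⟩
    have := mem (r₁.full (List.append_subset.2 ⟨List.subset_append_left _ _,
      List.Subset.trans hsub (List.subset_append_right _ _)⟩) (r₂.full hsub h'))
    omega

/-! ### Regular languages -/

namespace NIDPDAwtl

variable {α σ : Type}

open Classical in
/-- A deterministic finite automaton as an automaton that neither uses the pushdown nor
translucency. -/
noncomputable def ofDFA [Finite σ] (D : DFA α σ) : NIDPDAwtl α where
  Q := σ
  Γ := Empty
  finiteQ := inferInstance
  finiteΓ := inferInstance
  signature _ := .neutral
  q₀ := D.start
  τ _ := ∅
  δD _ _ _ := none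
  δR _ _ _ := none
  δN q x _ :=
    match x with
    | some a => some (.moves {D.step q a})
    | none => if q ∈ D.accept then some .accept else none

/-- As nothing is translucent, each step processes the first letter, and the endmarker is seen only
when the input is exhausted. -/
theorem language_ofDFA [Finite σ] (D : DFA α σ) : (ofDFA D).language = D.accepts := by
  ext w
  constructor
  · intro h
    suffices key : ∀ c, Relation.ReflTransGen (ofDFA D).Step c .accept →
        ∀ (q : σ) (w : List α) (γ : List Empty), c = .run q w γ → D.evalFrom q w ∈ D.accept from
      key _ h _ _ _ rfl
    intro c h
    induction h using Relation.ReflTransGen.head_induction_on with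
    | refl => intro q w γ hc; cases hc
    | head hs _ ih =>
      rintro q w γ rfl
      cases hs with
      | push h => cases h
      | pop h => cases h
      | @neutral _ q' x y a _ S h hx ha hδ hS =>
        cases x with
        | nil =>
          simp only [ofDFA, Option.some.injEq] at hδ
          obtain rfl := Outcome.moves.inj hδ
          obtain rfl : q' = D.step q a := hS
          simpa using ih _ _ _ rfl
        | cons b x => exact (hx b (by simp)).elim
      | endmarker hx hδ hS =>
        simp only [ofDFA] at hδ
        split_ifs at hδ
        simp at hδ
      | acceptPush h => cases h
      | acceptPop h => cases h
      | acceptNeutral h hx ha hδ => simp [ofDFA] at hδ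
      | acceptEndmarker hx hδ =>
        cases w with
        | nil =>
          simp only [ofDFA] at hδ
          split_ifs at hδ with hq
          exact hq
        | cons b x => exact (hx b (by simp)).elim
  · intro h
    suffices key : ∀ (w : List α) (q : σ), D.evalFrom q w ∈ D.accept →
        Relation.ReflTransGen (ofDFA D).Step (.run q w []) .accept from key w _ h
    intro w
    induction w with
    | nil =>
      intro q hq
      exact .single (.acceptEndmarker (by simp) (if_pos hq))
    | cons a w ih =>
      intro q hq
      exact .head (.neutral (M := ofDFA D) (x := []) rfl (by simp) (by simp [ofDFA]) rfl rfl)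
        (ih (D.step q a) hq)

end NIDPDAwtl

theorem mem_kstar_singleton {α : Type} {x : α} {w : List α} :
    w ∈ ({[x]} : Language α)∗ ↔ ∃ n, w = List.replicate n x := by
  rw [Language.mem_kstar]
  constructor
  · rintro ⟨L, rfl, hL⟩
    refine ⟨L.length, ?_⟩
    rw [List.eq_replicate_of_mem hL]
    simp
  · rintro ⟨n, rfl⟩
    exact ⟨List.replicate n [x], by simp, fun y hy => List.eq_of_mem_replicate hy⟩

theorem mem_starABC {w : List ABC} : w ∈ starABC ↔ ∃ i j k,
    w = List.replicate i ABC.a ++ List.replicate j ABC.b ++ List.replicate k ABC.c := by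
  simp only [starABC, Language.mem_mul, mem_kstar_singleton]
  constructor
  · rintro ⟨_, ⟨_, ⟨i, rfl⟩, _, ⟨j, rfl⟩, rfl⟩, _, ⟨k, rfl⟩, rfl⟩
    exact ⟨i, j, k, rfl⟩
  · rintro ⟨i, j, k, rfl⟩
    exact ⟨_, ⟨_, ⟨i, rfl⟩, _, ⟨j, rfl⟩, rfl⟩, _, ⟨k, rfl⟩, rfl⟩

/-- A deterministic finite automaton for `a*b*c*`. It remembers the letter whose block it is in;
`none` is the rejecting sink. -/
def dfaABC : DFA ABC (Option ABC) where
  step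
    | some .a, x => some x
    | some .b, .b => some .b
    | some .b, .c => some .c
    | some .c, .c => some .c
    | _, _ => none
  start := some .a
  accept := {none}ᶜ

theorem dfaABC_evalFrom_none (w : List ABC) : dfaABC.evalFrom none w = none := by
  induction w with
  | nil => rfl
  | cons x w ih => exact ih

theorem dfaABC_evalFrom_c {w : List ABC} (h : dfaABC.evalFrom (some .c) w ≠ none) :
    ∃ k, w = List.replicate k ABC.c := by
  induction w with
  | nil => exact ⟨0, rfl⟩
  | cons x w ih =>
    cases x with
    | a => exact (h (dfaABC_evalFrom_none w)).elim
    | b => exact (h (dfaABC_evalFrom_none w)).elim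
    | c =>
      obtain ⟨k, rfl⟩ := ih h
      exact ⟨k + 1, rfl⟩

theorem dfaABC_evalFrom_b {w : List ABC} (h : dfaABC.evalFrom (some .b) w ≠ none) :
    ∃ j k, w = List.replicate j ABC.b ++ List.replicate k ABC.c := by
  induction w with
  | nil => exact ⟨0, 0, rfl⟩
  | cons x w ih =>
    cases x with
    | a => exact (h (dfaABC_evalFrom_none w)).elim
    | b =>
      obtain ⟨j, k, rfl⟩ := ih h
      exact ⟨j + 1, k, rfl⟩
    | c =>
      obtain ⟨k, rfl⟩ := dfaABC_evalFrom_c h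
      exact ⟨0, k + 1, rfl⟩

theorem dfaABC_evalFrom_a {w : List ABC} (h : dfaABC.evalFrom (some .a) w ≠ none) :
    ∃ i j k, w = List.replicate i ABC.a ++ List.replicate j ABC.b ++ List.replicate k ABC.c := by
  induction w with
  | nil => exact ⟨0, 0, 0, rfl⟩
  | cons x w ih =>
    cases x with
    | a =>
      obtain ⟨i, j, k, rfl⟩ := ih h
      exact ⟨i + 1, j, k, rfl⟩
    | b =>
      obtain ⟨j, k, rfl⟩ := dfaABC_evalFrom_b h
      exact ⟨0, j + 1, k, rfl⟩
    | c =>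
      obtain ⟨k, rfl⟩ := dfaABC_evalFrom_c h
      exact ⟨0, 0, k + 1, rfl⟩

theorem accepts_dfaABC : dfaABC.accepts = starABC := by
  ext w
  rw [mem_starABC]
  refine ⟨dfaABC_evalFrom_a, ?_⟩
  have hc : ∀ k, dfaABC.evalFrom (some .c) (List.replicate k ABC.c) ≠ none := fun k => by
    induction k with
    | zero => exact Option.some_ne_none _
    | succ k ih => exact ih
  have hb : ∀ j k, dfaABC.evalFrom (some .b)
      (List.replicate j ABC.b ++ List.replicate k ABC.c) ≠ none := fun j k => by
    induction j with
    | zero =>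
      cases k with
      | zero => exact Option.some_ne_none _
      | succ k => exact hc k
    | succ j ih => exact ih
  rintro ⟨i, j, k, rfl⟩
  rw [List.append_assoc]
  change dfaABC.evalFrom (some .a) _ ≠ none
  induction i with
  | zero =>
    cases j with
    | zero =>
      cases k with
      | zero => exact Option.some_ne_none _
      | succ k => exact hc k
    | succ j => exact hb j k
  | succ i ih => exact ih

theorem isRegular_starABC : starABC.IsRegular := by
  have := Fintype.ofFinite (Option ABC)
  exact ⟨Option ABC, this, dfaABC, accepts_dfaABC⟩

/-! ### The language of the words with equally many letters of each kind -/

/-- The cyclic successor of a letter. -/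
def ABC.next : ABC → ABC
  | .a => .b
  | .b => .c
  | .c => .a

/-- An automaton without pushdown operations that deletes cyclically an `a`, a `b`, and a `c`.
The state `some x` looks for the next `x`; the state `none` checks that nothing is left. -/
def cyclicABC : NIDPDAwtl ABC where
  Q := Option ABC
  Γ := Empty
  finiteQ := inferInstance
  finiteΓ := inferInstance
  signature _ := .neutral
  q₀ := some .a
  τ
    | some x => {x}ᶜ
    | none => ∅
  δD _ _ _ := none
  δR _ _ _ := none
  δN q x _ :=
    match q, x with
    | some x, some _ => some (.moves {some x.next})
    | some .a, none => some (.moves {none})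
    | none, none => some .accept
    | _, _ => none

/-- The words that `cyclicABC` accepts from a given state. -/
def cyclicInvariant : Option ABC → List ABC → Prop
  | some .a, w => w.count .a = w.count .b ∧ w.count .b = w.count .c
  | some .b, w => w.count .a + 1 = w.count .b ∧ w.count .b = w.count .c
  | some .c, w => w.count .a = w.count .b ∧ w.count .b + 1 = w.count .c
  | none, w => w = []

theorem cyclicABC_step_erase {x : ABC} {w : List ABC} (hx : x ∈ w) :
    cyclicABC.Step (.run (some x) w []) (.run (some x.next) (w.erase x) []) := by
  obtain ⟨u, v, hu, rfl, e⟩ := List.exists_erase_eq hx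
  rw [e]
  refine .neutral (M := cyclicABC) rfl (fun y hy => ?_) (by simp [cyclicABC]) rfl rfl
  rintro rfl
  exact hu hy

theorem cyclicABC_accepts_of_count {n : ℕ} {w : List ABC} (ha : w.count .a = n)
    (hb : w.count .b = n) (hc : w.count .c = n) :
    Relation.ReflTransGen cyclicABC.Step (.run (some .a) w []) .accept := by
  induction n generalizing w with
  | zero =>
    obtain rfl : w = [] := List.eq_nil_iff_forall_not_mem.2 fun x => by
      cases x
      · exact List.count_eq_zero.1 ha
      · exact List.count_eq_zero.1 hb
      · exact List.count_eq_zero.1 hc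
    -- With no `a` left, `some .a` sees the endmarker and passes to `none`, where any leftover
    -- letter would block the computation.
    exact .head (.endmarker (M := cyclicABC) (q' := none) (by simp) rfl rfl)
      (.single (.acceptEndmarker (M := cyclicABC) (by simp) rfl))
  | succ n ih =>
    have h₁ : ABC.a ∈ w := List.count_pos_iff.1 (by omega)
    have h₂ : ABC.b ∈ w.erase .a := List.count_pos_iff.1 (by
      rw [List.count_erase_of_ne (by decide)]; omega)
    have h₃ : ABC.c ∈ (w.erase .a).erase .b := List.count_pos_iff.1 (by
      rw [List.count_erase_of_ne (by decide), List.count_erase_of_ne (by decide)]; omega)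
    refine .head (cyclicABC_step_erase h₁) (.head (cyclicABC_step_erase h₂)
      (.head (cyclicABC_step_erase h₃) (ih ?_ ?_ ?_))) <;>
    simp [ABC.next, *]

theorem cyclicInvariant_of_accepts {c : cyclicABC.Config}
    (h : Relation.ReflTransGen cyclicABC.Step c .accept) :
    ∀ (q : Option ABC) (w : List ABC) (γ : List Empty), c = .run q w γ →
      cyclicInvariant q w := by
  induction h using Relation.ReflTransGen.head_induction_on with
  | refl => intro q w γ hc; cases hc
  | head hs _ ih =>
    rintro q w γ rfl
    cases hs with
    | push h => cases h
    | pop h => cases h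
    | @neutral _ q' x y l _ S h hx ha hδ hS =>
      cases q with
      | none => simp [cyclicABC] at hδ
      | some z =>
        -- All letters but `z` are translucent in the state `some z`.
        obtain rfl : l = z := by simpa [cyclicABC] using ha
        simp only [cyclicABC, Option.some.injEq] at hδ
        obtain rfl := Outcome.moves.inj hδ
        obtain rfl : q' = some l.next := hS
        have := ih _ _ _ rfl
        cases l <;> simp [cyclicInvariant, ABC.next] at this ⊢ <;> omega
    | @endmarker _ q' _ _ S hx hδ hS =>
      rcases q with _ | (_ | _ | _) <;> simp [cyclicABC] at hδ
      obtain rfl := Outcome.moves.inj hδ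
      obtain rfl : q' = none := hS
      obtain rfl : w = [] := ih _ _ _ rfl
      exact ⟨rfl, rfl⟩
    | acceptPush h => cases h
    | acceptPop h => cases h
    | acceptNeutral h hx ha hδ => rcases q with _ | (_ | _ | _) <;> simp [cyclicABC] at hδ
    | acceptEndmarker hx hδ =>
      rcases q with _ | (_ | _ | _) <;> simp [cyclicABC] at hδ
      exact List.eq_nil_iff_forall_not_mem.2 hx

theorem language_cyclicABC : cyclicABC.language = equalCountABC := by
  ext w
  constructor
  · exact fun h => cyclicInvariant_of_accepts h _ _ _ rfl
  · rintro ⟨h₁, h₂⟩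
    exact cyclicABC_accepts_of_count rfl h₁.symm (h₁.trans h₂).symm

theorem equalCountABC_inf_starABC : equalCountABC ⊓ starABC = powABC := by
  ext w
  constructor
  · rintro ⟨⟨h₁, h₂⟩, h⟩
    obtain ⟨i, j, k, rfl⟩ := mem_starABC.1 h
    simp [List.count_replicate] at h₁ h₂
    subst h₁ h₂
    exact ⟨_, rfl⟩
  · rintro ⟨n, rfl⟩
    exact ⟨⟨by simp [List.count_replicate], by simp [List.count_replicate]⟩,
      mem_starABC.2 ⟨n, n, n, rfl⟩⟩

/-! ### Assembly of the results -/

theorem proposition8 :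
    ¬ NIDPDAwtl.ClosedUnderIntersection ∧
    ¬ NIDPDAwtl.ClosedUnderIntersectionWithRegular ∧
    (∃ M₁ M₂ : NIDPDAwtl ABC, M₁.signature = M₂.signature ∧
      M₁.language = equalCountABC ∧ M₂.language = starABC) ∧
    starABC.IsRegular ∧
    equalCountABC ⊓ starABC = powABC ∧
    (∀ K : Language ABC, K.IsContextFree → K ≤ powABC → ¬ LetterEquivalent K powABC) ∧
    powABC ∉ NIDPDAwtl.family ABC := by
  have h₁ : equalCountABC ∈ NIDPDAwtl.family ABC := ⟨_, language_cyclicABC⟩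
  have hs := (NIDPDAwtl.language_ofDFA dfaABC).trans accepts_dfaABC
  refine ⟨fun h => ?_, fun h => ?_, ⟨cyclicABC, .ofDFA dfaABC, rfl, language_cyclicABC, hs⟩, isRegular_starABC,
    equalCountABC_inf_starABC, fun K hK hle he => ?_, powABC_notMem_family⟩
  · exact powABC_notMem_family (equalCountABC_inf_starABC ▸ h ABC _ _ h₁ ⟨_, hs⟩)
  · exact powABC_notMem_family (equalCountABC_inf_starABC ▸ h ABC _ _ h₁ isRegular_starABC)
  · exact not_isContextFree_powABC (he.eq_powABC hle ▸ hK)
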